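/- (Kato) Let $f$ be a rational function with complex coefficients such that $f(\infty)=\infty$ (i.e. $|f(z)|\to\infty$ as $|z|\to\infty$) and such that the lemniscate $\Omega=\{z\in\mathbb C : |f(z)|<1\}$ (poles of $f$ do not belong to $\Omega$) is convex. Let $H$ be a complex Hilbert space and let $A$ be a continuous linear operator on $H$ whose numerical range $W(A)=\{\langle Ax,x\rangle : x\in H,\ \|x\|=1\}$ is contained in the closure $\overline\Omega$. Then $f(A)$ is well defined (no pole of $f$ lies in the spectrum of $A$), and $$W(f(A))\subset\overline D,\qquad D=\{z\in\mathbb C : |z|<1\}.$$ Moreover $f(A)$ has a unitary $2$-dilation: there exist a Hilbert space $K$ containing $H$ as a closed subspace and a unitary operator $U$ on $K$ such that $$f(A)^k = 2\,P_H U^k|_H\qquad\text{for all integers } k\ge 1,$$ where $P_H$ denotes the orthogonal projection of $K$ onto $H$. -/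

import Mathlib

open Filter Topology

/-- The numerical range `W(A) = {⟨A x, x⟩ : ‖x‖ = 1}`. Mathlib's inner product is linear in the
second variable, so `⟨A x, x⟩` (linear in the first one) is `inner ℂ x (A x)`. -/
def numericalRange {H : Type*} [NormedAddCommGroup H] [InnerProductSpace ℂ H]
    (A : H →L[ℂ] H) : Set ℂ :=
  {w | ∃ x : H, ‖x‖ = 1 ∧ inner ℂ x (A x) = w}

/-- The lemniscate `{z ∈ ℂ : |f z| < 1}` of a rational function. The value at a pole is `∞`, so
poles do not belong to it (while `RatFunc.eval` returns `0` there). -/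
def lemniscate (f : RatFunc ℂ) : Set ℂ :=
  {z | f.denom.eval z ≠ 0 ∧ ‖f.eval (RingHom.id ℂ) z‖ < 1}

/-- The condition `f(∞) = ∞`. -/
def MapsInftyToInfty (f : RatFunc ℂ) : Prop :=
  Tendsto (fun z : ℂ => f.eval (RingHom.id ℂ) z) (cocompact ℂ) (cocompact ℂ)

/-- `f(A)` is defined for `f = p / q` in lowest terms when `q(A)` is invertible in `L(H)`
(that is, when no pole of `f` lies in the spectrum of `A`). -/
def RatFuncDefinedAt {H : Type*} [NormedAddCommGroup H] [InnerProductSpace ℂ H]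
    (f : RatFunc ℂ) (A : H →L[ℂ] H) : Prop :=
  IsUnit (Polynomial.aeval A f.denom)

/-- The operator `f(A) = p(A) q(A)⁻¹`, for `f = p / q` in lowest terms. -/
noncomputable def ratFuncApply {H : Type*} [NormedAddCommGroup H] [InnerProductSpace ℂ H]
    (f : RatFunc ℂ) (A : H →L[ℂ] H) : H →L[ℂ] H :=
  Polynomial.aeval A f.num * Ring.inverse (Polynomial.aeval A f.denom)

/-- `T` has a unitary 2-dilation: there are a Hilbert space `K` containing `H` (through an isometric
embedding `V`, so that compressing to `H` is `S ↦ V† S V`) and a unitary operator `U` on `K`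
with `T ^ k = 2 P_H U ^ k |_H` for all `k ≥ 1`. -/
def HasUnitaryTwoDilation.{u} {H : Type u} [NormedAddCommGroup H] [InnerProductSpace ℂ H]
    [CompleteSpace H] (T : H →L[ℂ] H) : Prop :=
  ∃ (K : Type u) (_ : NormedAddCommGroup K) (_ : InnerProductSpace ℂ K) (_ : CompleteSpace K)
    (V : H →ₗᵢ[ℂ] K) (U : K →L[ℂ] K),
    U ∈ unitary (K →L[ℂ] K) ∧
      ∀ k : ℕ, 1 ≤ k →
        T ^ k = (2 : ℂ) • (ContinuousLinearMap.adjoint V.toContinuousLinearMap ∘L (U ^ k) ∘L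
          V.toContinuousLinearMap)

/-! Both conclusions reduce to `re_inner_ratFuncApply_le`: `T = f(A)` has numerical radius at most
1. Write `f = p/q` and `x = q(A)y`; for `|ζ| = 1` the claim is `Re (conj ζ ⟪q(A)y, g(A)y⟫) ≥ 0` with
`g = ζq - p`. Since `f(∞) = ∞`, `deg q < deg g`. If `ζ` is not a critical value, `g` has simple
roots `z` and `q = ∑ c_z N_z`, where `g = (X - z)N_z` and `c_z = q(z)/g'(z)`. With `u_z = N_z(A)y`
the expression splits into terms `Re (conj (ζ c_z) ⟪u_z, (A - z)u_z⟫)`. Each is nonnegative: `|f(z)|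
= 1`, and by convexity `W(A)` lies in the half-plane bounded by the tangent to the lemniscate at `z`
(`Polynomial.re_mul_logDeriv_nonpos`). The finitely many critical values follow by continuity.

For the dilation, numerical radius at most 1 makes the Toeplitz kernel `berger T` positive
semidefinite; on its reproducing kernel space the shift is unitary. -/

/-! ### Unitary 2-dilations of operators with numerical radius at most 1. -/

section Dilation

open scoped InnerProductSpace

variable {H : Type*} [NormedAddCommGroup H] [InnerProductSpace ℂ H]

/-- Discrete Parseval identity over the `N`-th roots of unity. -/
theorem IsPrimitiveRoot.sum_inner_fourier {N : ℕ} {ω : ℂ} (hω : IsPrimitiveRoot ω N) (hN : N ≠ 0)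
    (u w : ℕ → H) :
    ∑ m ∈ Finset.range N, ⟪∑ j ∈ Finset.range N, (ω ^ m) ^ j • u j,
        ∑ i ∈ Finset.range N, (ω ^ m) ^ i • w i⟫_ℂ
      = N * ∑ i ∈ Finset.range N, ⟪u i, w i⟫_ℂ := by
  have hω1 : ‖ω‖ = 1 := hω.norm'_eq_one hN
  have hconj : (starRingEnd ℂ) ω = ω⁻¹ := (Complex.inv_eq_conj hω1).symm
  have hω0 : ω ≠ 0 := hω.ne_zero hN
  have key : ∀ i ∈ Finset.range N, ∀ j ∈ Finset.range N,
      ∑ m ∈ Finset.range N, (starRingEnd ℂ) ((ω ^ m) ^ j) * (ω ^ m) ^ i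
        = if i = j then (N : ℂ) else 0 := by
    intro i hi j hj
    have h1 : ∀ m, (starRingEnd ℂ) ((ω ^ m) ^ j) * (ω ^ m) ^ i = ((ω ^ j)⁻¹ * ω ^ i) ^ m := by
      intro m
      simp only [map_pow, hconj, mul_pow, inv_pow, ← pow_mul, mul_comm]
    simp only [h1]
    split_ifs with h
    · subst h
      simp [hω0]
    · have hne : (ω ^ j)⁻¹ * ω ^ i ≠ 1 := by
        intro h2
        apply h
        rw [inv_mul_eq_one₀ (pow_ne_zero _ hω0)] at h2
        exact (hω.pow_inj (Finset.mem_range.1 hj) (Finset.mem_range.1 hi) h2).symm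
      have h3 := mul_neg_geom_sum ((ω ^ j)⁻¹ * ω ^ i) N
      have h4 : ((ω ^ j)⁻¹ * ω ^ i) ^ N = 1 := by
        rw [mul_pow, inv_pow, ← pow_mul, ← pow_mul, mul_comm j, mul_comm i, pow_mul, pow_mul,
          hω.pow_eq_one]
        simp
      rw [h4, sub_self] at h3
      exact (mul_eq_zero.1 h3).resolve_left (sub_ne_zero.2 hne.symm)
  simp only [sum_inner, inner_sum, inner_smul_left, inner_smul_right]
  rw [Finset.sum_comm, Finset.mul_sum]
  refine Finset.sum_congr rfl fun i hi => ?_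
  simp_rw [Finset.mul_sum]
  rw [Finset.sum_comm]
  calc _ = ∑ j ∈ Finset.range N, (if i = j then (N : ℂ) else 0) * ⟪u j, w i⟫_ℂ := by
        refine Finset.sum_congr rfl fun j hj => ?_
        rw [← key i hi j hj, Finset.sum_mul]
        refine Finset.sum_congr rfl fun m _ => ?_
        ring
    _ = _ := by simp [Finset.mem_range.1 hi]

/-- If `Re ζ⟨T x, x⟩ ≤ ‖x‖²` for all unimodular `ζ`, then the tridiagonal operator matrix
`1 - Re (T ⊗ shift)` is positive on finite sequences. -/
theorem re_sum_inner_sub_shift_nonneg {T : H →L[ℂ] H}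
    (hT : ∀ ζ : ℂ, ‖ζ‖ = 1 → ∀ x, (ζ * ⟪x, T x⟫_ℂ).re ≤ ‖x‖ ^ 2) (n : ℕ) (y : ℕ → H) :
    0 ≤ ∑ k ∈ Finset.range n, (⟪y k, y k - (if k = 0 then 0 else T (y (k - 1)))⟫_ℂ).re := by
  -- The extra slot carries `u n = 0`, so the cyclic Fourier transform sees the plain shift without
  -- wrap-around.
  set N := n + 1 with hN
  have hN0 : N ≠ 0 := Nat.succ_ne_zero n
  obtain ⟨ω, hω⟩ : ∃ ω : ℂ, IsPrimitiveRoot ω N := ⟨_, Complex.isPrimitiveRoot_exp N hN0⟩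
  set u : ℕ → H := fun k => if k < n then y k else 0 with hu
  set w : ℕ → H := fun k => if k = 0 then 0 else T (u (k - 1)) with hw
  have hpar := hω.sum_inner_fourier hN0 u (fun k => u k - w k)
  have hterm : ∀ m ∈ Finset.range N, 0 ≤ (⟪∑ j ∈ Finset.range N, (ω ^ m) ^ j • u j,
        ∑ i ∈ Finset.range N, (ω ^ m) ^ i • (u i - w i)⟫_ℂ).re := by
    intro m _
    set v := ∑ j ∈ Finset.range N, (ω ^ m) ^ j • u j with hv
    have hshift : ∑ i ∈ Finset.range N, (ω ^ m) ^ i • w i = ω ^ m • T v := by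
      have hv' : v = ∑ j ∈ Finset.range n, (ω ^ m) ^ j • u j := by
        rw [hv, hN, Finset.sum_range_succ]
        simp [hu]
      rw [hv', hN, Finset.sum_range_succ', map_sum, Finset.smul_sum]
      simp [hw, pow_succ', mul_smul]
    simp only [smul_sub, Finset.sum_sub_distrib]
    rw [hshift, inner_sub_right, inner_smul_right, Complex.sub_re]
    have h1 := hT (ω ^ m) (by rw [norm_pow, hω.norm'_eq_one hN0, one_pow]) v
    have h2 : (⟪v, v⟫_ℂ).re = ‖v‖ ^ 2 := by
      simpa using inner_self_eq_norm_sq (𝕜 := ℂ) v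
    linarith
  have hsum : 0 ≤ ((N : ℂ) * ∑ i ∈ Finset.range N, ⟪u i, u i - w i⟫_ℂ).re := by
    rw [← hpar, Complex.re_sum]
    exact Finset.sum_nonneg hterm
  have hre : ((N : ℂ) * ∑ i ∈ Finset.range N, ⟪u i, u i - w i⟫_ℂ).re
      = N * ∑ i ∈ Finset.range N, (⟪u i, u i - w i⟫_ℂ).re := by
    rw [← Complex.ofReal_natCast, Complex.re_ofReal_mul, Complex.re_sum]
  rw [hre] at hsum
  have hpos := nonneg_of_mul_nonneg_right hsum (by positivity : (0 : ℝ) < N)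
  rw [hN, Finset.sum_range_succ] at hpos
  have hlast : u n = 0 := by simp [hu]
  rw [hlast] at hpos
  simp only [inner_zero_left, Complex.zero_re, add_zero] at hpos
  refine hpos.trans_eq (Finset.sum_congr rfl fun k hk => ?_)
  have hk' := Finset.mem_range.1 hk
  have h1 : k - 1 < n := by omega
  simp [hu, hw, hk', h1]

/-- Substitute `y = (1 - T ⊗ shift)⁻¹ h`, a finite Neumann sum, into the previous inequality. -/
theorem re_sum_inner_pow_nonneg {T : H →L[ℂ] H}
    (hT : ∀ ζ : ℂ, ‖ζ‖ = 1 → ∀ x, (ζ * ⟪x, T x⟫_ℂ).re ≤ ‖x‖ ^ 2) (n : ℕ) (h : ℕ → H) :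
    0 ≤ ∑ k ∈ Finset.range n, ∑ j ∈ Finset.range (k + 1), (⟪(T ^ (k - j)) (h j), h k⟫_ℂ).re := by
  set y : ℕ → H := fun k => ∑ j ∈ Finset.range (k + 1), (T ^ (k - j)) (h j) with hy
  refine (re_sum_inner_sub_shift_nonneg hT n y).trans_eq (Finset.sum_congr rfl fun k _ => ?_)
  have hyk : y k - (if k = 0 then 0 else T (y (k - 1))) = h k := by
    rcases k with _ | k
    · simp [hy]
    · simp only [hy, Nat.succ_ne_zero, if_false, Nat.add_sub_cancel]
      rw [Finset.sum_range_succ _ (k + 1), map_sum, Nat.sub_self, pow_zero,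
        sub_eq_iff_eq_add, add_comm]
      congr 1
      refine Finset.sum_congr rfl fun j hj => ?_
      have : k + 1 - j = (k - j) + 1 := by have := Finset.mem_range.1 hj; omega
      rw [this, pow_succ']
      rfl
  rw [hyk, hy, sum_inner, Complex.re_sum]

/-- If the Gram kernel of a total family `κ x v`, `x : ℤ`, depends only on differences, then the
backward shift `κ x v ↦ κ (x - 1) v` is implemented by a unitary operator. -/
theorem exists_unitary_shift {K : Type*} [NormedAddCommGroup K] [InnerProductSpace ℂ K]
    [CompleteSpace K] (S : ℤ → (H →L[ℂ] H)) (κ : ℤ → (H →L[ℂ] K))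
    (hinner : ∀ x y v w, ⟪κ x v, κ y w⟫_ℂ = ⟪v, S (x - y) w⟫_ℂ)
    (hspan : (Submodule.span ℂ {κ x v | (x) (v)}).topologicalClosure = ⊤) :
    ∃ U ∈ unitary (K →L[ℂ] K), ∀ k : ℕ, (U ^ k) ∘L κ 0 = κ (-k) := by
  let e : (ℤ →₀ H) →ₗ[ℂ] K := Finsupp.lsum ℂ fun x => (κ x).toLinearMap
  have he : ∀ x v, e (Finsupp.single x v) = κ x v := by
    intro x v
    simp [e]
  have hdense : DenseRange e := by
    have h1 : (LinearMap.range e).topologicalClosure = ⊤ := by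
      rw [eq_top_iff, ← hspan]
      refine Submodule.topologicalClosure_mono (Submodule.span_le.2 ?_)
      rintro _ ⟨x, v, rfl⟩
      exact ⟨Finsupp.single x v, he x v⟩
    exact Submodule.dense_iff_topologicalClosure_eq_top.2 h1
  let σ : (ℤ →₀ H) ≃ₗ[ℂ] (ℤ →₀ H) := Finsupp.domLCongr (Equiv.subRight (1 : ℤ))
  have hσ : ∀ x v, σ (Finsupp.single x v) = Finsupp.single (x - 1) v := by
    intro x v
    simp [σ]
  have hσinner : ∀ x y, ⟪e (σ x), e (σ y)⟫_ℂ = ⟪e x, e y⟫_ℂ := by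
    intro x y
    induction x using Finsupp.induction_linear with
    | zero => simp
    | add a b ha hb => simp only [map_add, inner_add_left, ha, hb]
    | single i v =>
      induction y using Finsupp.induction_linear with
      | zero => simp
      | add a b ha hb => simp only [map_add, inner_add_right, ha, hb]
      | single j w => rw [hσ, hσ, he, he, he, he, hinner, hinner, sub_sub_sub_cancel_right]
  have hnorm : ∀ x, ‖e (σ x)‖ = ‖e x‖ := by
    intro x
    rw [@norm_eq_sqrt_re_inner ℂ, @norm_eq_sqrt_re_inner ℂ, hσinner]
  let U := σ.extendOfIsometry e e hdense hdense hnorm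
  have hU : ∀ x v, U (κ x v) = κ (x - 1) v := by
    intro x v
    rw [← he, ← he, LinearEquiv.extendOfIsometry_eq, hσ]
  refine ⟨Unitary.linearIsometryEquiv.symm U, (Unitary.linearIsometryEquiv.symm U).2, fun k => ?_⟩
  induction k with
  | zero => ext; simp
  | succ k ih =>
    ext v
    have ih' := DFunLike.congr_fun ih v
    rw [ContinuousLinearMap.comp_apply] at ih' ⊢
    rw [pow_succ', mul_apply_eq_comp, ih']
    refine (hU _ _).trans ?_
    congr 2
    push_cast
    ring

/-- A positive semidefinite Toeplitz kernel on `ℤ` dilates to the powers of a unitary operator. -/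
theorem exists_unitary_of_toeplitz_posSemidef.{u} {H : Type u} [NormedAddCommGroup H]
    [InnerProductSpace ℂ H] [CompleteSpace H] (S : ℤ → (H →L[ℂ] H)) (hS0 : S 0 = 1)
    (hS : (Matrix.of fun i j : ℤ => S (i - j)).PosSemidef) :
    ∃ (K : Type u) (_ : NormedAddCommGroup K) (_ : InnerProductSpace ℂ K) (_ : CompleteSpace K)
      (V : H →ₗᵢ[ℂ] K) (U : K →L[ℂ] K), U ∈ unitary (K →L[ℂ] K) ∧
      ∀ k : ℕ, S k = ContinuousLinearMap.adjoint V.toContinuousLinearMap ∘L (U ^ k) ∘L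
          V.toContinuousLinearMap := by
  have : Fact (Matrix.of fun i j : ℤ => S (i - j)).PosSemidef := ⟨hS⟩
  let κ := RKHS.kerFun (RKHS.OfKernel (Matrix.of fun i j : ℤ => S (i - j)))
  have hκ : ∀ x y : ℤ, ContinuousLinearMap.adjoint (κ x) ∘L κ y = S (x - y) := by
    intro x y
    rw [← RKHS.kernel_apply, RKHS.OfKernel.kernel_ofKernel]
    rfl
  have hinner : ∀ x y v w, ⟪κ x v, κ y w⟫_ℂ = ⟪v, S (x - y) w⟫_ℂ := by
    intro x y v w
    rw [← hκ, ContinuousLinearMap.comp_apply, ContinuousLinearMap.adjoint_inner_right]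
  obtain ⟨U, hU, hUk⟩ := exists_unitary_shift S κ hinner (RKHS.kerFun_dense _)
  let V := (κ 0).toLinearMap.isometryOfInner fun v w => by
    simpa [hS0] using hinner 0 0 v w
  have hV : V.toContinuousLinearMap = κ 0 := rfl
  refine ⟨_, inferInstance, inferInstance, inferInstance, V, U, hU, fun k => ?_⟩
  -- `U` shifts backwards so that `(κ 0)† κ (-k)` is `S k`, not `S (-k)`.
  rw [hV, hUk, hκ, zero_sub, neg_neg]

/-- The Toeplitz symbol of the unitary `2`-dilation: `1` at `0`, `T ^ n / 2` at `n > 0`,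
and `(T†) ^ n / 2` at `-n < 0`. -/
noncomputable def berger [CompleteSpace H] (T : H →L[ℂ] H) (n : ℤ) : H →L[ℂ] H :=
  (2⁻¹ : ℂ) • ((if 0 ≤ n then T ^ n.toNat else 0) +
    (if n ≤ 0 then (ContinuousLinearMap.adjoint T) ^ (-n).toNat else 0))

theorem star_berger [CompleteSpace H] (T : H →L[ℂ] H) (n : ℤ) :
    star (berger T n) = berger T (-n) := by
  simp only [berger, star_smul, star_add, apply_ite star, star_pow, star_zero,
    ← ContinuousLinearMap.star_eq_adjoint, star_star, neg_neg, Left.nonneg_neg_iff,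
    Left.neg_nonpos_iff, add_comm]
  congr 1
  simp

theorem re_inner_berger [CompleteSpace H] (T : H →L[ℂ] H) (n : ℤ) (v w : H) :
    (⟪berger T n v, w⟫_ℂ).re = 2⁻¹ * ((if 0 ≤ n then (⟪(T ^ n.toNat) v, w⟫_ℂ).re else 0) +
      (if n ≤ 0 then (⟪(T ^ (-n).toNat) w, v⟫_ℂ).re else 0)) := by
  have h1 : (⟪((ContinuousLinearMap.adjoint T) ^ (-n).toNat) v, w⟫_ℂ).re
      = (⟪(T ^ (-n).toNat) w, v⟫_ℂ).re := by
    rw [← ContinuousLinearMap.star_eq_adjoint, ← star_pow, ContinuousLinearMap.star_eq_adjoint,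
      ContinuousLinearMap.adjoint_inner_left, ← inner_conj_symm, Complex.conj_re]
  rw [← h1]
  have h2 : (starRingEnd ℂ) (2⁻¹ : ℂ) = ((2⁻¹ : ℝ) : ℂ) := by
    rw [← Complex.conj_ofReal]
    simp
  rw [berger, smul_apply, inner_smul_left, h2, Complex.re_ofReal_mul]
  split_ifs <;> simp [inner_add_left]

/-- After translating the support into `0, …, n - 1`, the form is the symmetrization of the
triangular sum in `re_sum_inner_pow_nonneg`. The factor `1/2` in `berger` compensates for counting
each pair twice, the diagonal included. -/
theorem posSemidef_berger [CompleteSpace H] {T : H →L[ℂ] H}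
    (hT : ∀ ζ : ℂ, ‖ζ‖ = 1 → ∀ x, (ζ * ⟪x, T x⟫_ℂ).re ≤ ‖x‖ ^ 2) :
    (Matrix.of fun i j : ℤ => berger T (i - j)).PosSemidef := by
  have htfae := (RKHS.posSemidef_tfae (K := Matrix.of fun i j : ℤ => berger T (i - j))).out 0 2
  refine htfae.2 ⟨?_, fun f => ?_⟩
  · ext1 i j
    rw [Matrix.conjTranspose_apply, Matrix.of_apply, Matrix.of_apply, star_berger, neg_sub]
  · obtain ⟨a, n, hn⟩ : ∃ (a : ℤ) (n : ℕ),
        f.support ⊆ (Finset.range n).image fun k : ℕ => a + k := by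
      obtain ⟨b, hb⟩ := f.support.bddAbove
      obtain ⟨a, ha⟩ := f.support.bddBelow
      refine ⟨a, (b - a + 1).toNat, fun x hx => Finset.mem_image.2 ⟨(x - a).toNat, ?_, ?_⟩⟩
      · have := ha hx; have := hb hx
        simp only [Finset.mem_range]
        omega
      · have := ha hx
        omega
    have hsum : ∀ F : ℤ → H → ℝ, (∀ i, F i 0 = 0) →
        f.sum F = ∑ k ∈ Finset.range n, F (a + k) (f (a + k)) := by
      intro F hF
      rw [Finsupp.sum_of_support_subset f hn _ fun i _ => hF i, Finset.sum_image]
      intro x _ y _ hxy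
      simpa using hxy
    have hre : RCLike.re (f.sum fun x w => f.sum fun x' w' =>
          ⟪(Matrix.of fun i j : ℤ => berger T (i - j)) x' x w, w'⟫_ℂ)
        = ∑ j ∈ Finset.range n, ∑ k ∈ Finset.range n,
          (⟪berger T ((k : ℤ) - j) (f (a + j)), f (a + k)⟫_ℂ).re := by
      simp only [Finsupp.sum, map_sum]
      have h1 := hsum (fun x w => f.sum fun x' w' => (⟪berger T (x' - x) w, w'⟫_ℂ).re)
        (fun i => by simp)
      simp only [Finsupp.sum] at h1
      refine h1.trans (Finset.sum_congr rfl fun j _ => ?_)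
      have h2 := hsum (fun x' w' => (⟪berger T (x' - (a + j)) (f (a + j)), w'⟫_ℂ).re)
        (fun i => by simp)
      refine h2.trans (Finset.sum_congr rfl fun k _ => ?_)
      rw [add_sub_add_left_eq_sub]
    rw [hre]
    have hpos := re_sum_inner_pow_nonneg hT n fun k => f (a + k)
    refine hpos.trans_eq ?_
    set G : ℕ → ℕ → ℝ := fun j k => if j ≤ k then
      (⟪(T ^ (k - j)) (f (a + j)), f (a + k)⟫_ℂ).re else 0 with hG
    have hb : ∀ j k : ℕ, (⟪berger T ((k : ℤ) - j) (f (a + j)), f (a + k)⟫_ℂ).re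
        = 2⁻¹ * (G j k + G k j) := by
      intro j k
      rw [re_inner_berger]
      have e1 : ((k : ℤ) - j).toNat = k - j := by omega
      have e2 : (-((k : ℤ) - j)).toNat = j - k := by omega
      simp only [e1, e2, sub_nonneg, sub_nonpos, Nat.cast_le, hG]
    simp only [hb, ← Finset.mul_sum, Finset.sum_add_distrib]
    rw [Finset.sum_comm (f := fun j k => G k j), ← two_mul, inv_mul_cancel_left₀ two_ne_zero,
      Finset.sum_comm]
    refine Finset.sum_congr rfl fun k hk => ?_
    have hk' := Finset.mem_range.1 hk
    simp only [hG, ← Finset.sum_filter]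
    refine Finset.sum_congr ?_ fun _ _ => rfl
    ext j
    simp only [Finset.mem_range, Finset.mem_filter]
    omega

/-- **Berger's dilation theorem**: an operator with numerical radius at most `1` has a unitary
`2`-dilation. -/
theorem hasUnitaryTwoDilation_of_re_inner_le [CompleteSpace H] {T : H →L[ℂ] H}
    (hT : ∀ ζ : ℂ, ‖ζ‖ = 1 → ∀ x, (ζ * ⟪x, T x⟫_ℂ).re ≤ ‖x‖ ^ 2) :
    HasUnitaryTwoDilation T := by
  have h0 : berger T 0 = 1 := by
    ext x
    simp [berger, ← two_smul ℂ]
  obtain ⟨K, i1, i2, i3, V, U, hU, h⟩ :=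
    exists_unitary_of_toeplitz_posSemidef (berger T) h0 (posSemidef_berger hT)
  refine ⟨K, i1, i2, i3, V, U, hU, fun k hk => ?_⟩
  rw [← h k]
  have : k ≠ 0 := by omega
  simp [berger, this]

end Dilation

/-! ### Tangent half-planes, partial fractions and invertibility. -/

section Lemniscate

open Polynomial
open scoped InnerProductSpace

theorem RatFunc.eval_id_eq (f : RatFunc ℂ) (z : ℂ) :
    f.eval (RingHom.id ℂ) z = f.num.eval z / f.denom.eval z := rfl

theorem lemniscate_eq (f : RatFunc ℂ) :
    lemniscate f = {z | ‖f.num.eval z‖ < ‖f.denom.eval z‖} := by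
  ext z
  simp only [lemniscate, Set.mem_ofPred_eq, RatFunc.eval_id_eq, norm_div]
  constructor
  · rintro ⟨h0, h1⟩
    rwa [div_lt_one (norm_pos_iff.2 h0)] at h1
  · intro h
    have h0 : 0 < ‖f.denom.eval z‖ := (norm_nonneg _).trans_lt h
    exact ⟨norm_pos_iff.1 h0, (div_lt_one h0).2 h⟩

theorem MapsInftyToInfty.degree_denom_lt {f : RatFunc ℂ} (hf : MapsInftyToInfty f) :
    f.denom.degree < f.num.degree := by
  by_contra! h
  obtain ⟨C, hC0, hC⟩ := (isBigO_cobounded_of_degree_le h).exists_nonneg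
  rw [Asymptotics.isBigOWith_iff, Metric.cobounded_eq_cocompact] at hC
  have h1 := (tendsto_norm_cocompact_atTop.comp hf).eventually_gt_atTop C
  obtain ⟨z, hz1, hz2⟩ := (h1.and hC).exists
  simp only [Function.comp_apply, RatFunc.eval_id_eq, norm_div] at hz1
  exact absurd (div_le_of_le_mul₀ (norm_nonneg _) hC0 hz2) (not_le.2 hz1)

/-- Along a direction in which the logarithmic derivative of `p / q` has positive real part, the
modulus of `p / q` increases. -/
theorem Polynomial.eventually_norm_eval_lt (p q : ℂ[X]) {z d : ℂ} (hp : p.eval z ≠ 0)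
    (hpq : ‖p.eval z‖ = ‖q.eval z‖)
    (hd : 0 < (d * (p.derivative.eval z / p.eval z - q.derivative.eval z / q.eval z)).re) :
    ∀ᶠ t : ℝ in 𝓝[>] 0, ‖q.eval (z + t * d)‖ < ‖p.eval (z + t * d)‖ := by
  have hq : q.eval z ≠ 0 := by
    rw [← norm_ne_zero_iff, ← hpq]
    exact norm_ne_zero_iff.2 hp
  -- Normalized so that `F 0 = 1` and `F' 0` is `d` times the logarithmic derivative of `p / q`;
  -- then `Re F > 1` for small `t > 0`.
  set F : ℂ → ℂ := fun t => (p.eval (z + t * d) * q.eval z) / (q.eval (z + t * d) * p.eval z)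
  have hline : HasDerivAt (fun t : ℂ => z + t * d) d 0 := by
    simpa using ((hasDerivAt_id (0 : ℂ)).mul_const d).const_add z
  have hz : z + 0 * d = z := by ring
  have hP : ∀ r : ℂ[X], HasDerivAt (fun t : ℂ => r.eval (z + t * d))
      (r.derivative.eval z * d) 0 := by
    intro r
    have h := r.hasDerivAt (z + 0 * d)
    have h2 := h.comp (0 : ℂ) hline
    rw [hz] at h2
    exact h2
  have hF : HasDerivAt F
      (d * (p.derivative.eval z / p.eval z - q.derivative.eval z / q.eval z)) ((0 : ℝ) : ℂ) := by
    have h := ((hP p).mul_const (q.eval z)).div ((hP q).mul_const (p.eval z))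
      (by rw [hz]; exact mul_ne_zero hq hp)
    rw [hz] at h
    rw [Complex.ofReal_zero]
    exact h.congr_deriv (by field_simp)
  have hre := hF.real_of_complex
  have hF0 : F ((0 : ℝ) : ℂ) = 1 := by
    simp only [F, Complex.ofReal_zero, hz]
    rw [mul_comm]
    exact div_self (mul_ne_zero hq hp)
  have hslope := (hre.tendsto_slope_zero_right).eventually_const_lt hd
  filter_upwards [hslope, self_mem_nhdsWithin] with t ht ht0
  have ht0' : (0 : ℝ) < t := ht0
  rw [zero_add, hF0, Complex.one_re, smul_eq_mul] at ht
  have h1 : 1 < (F t).re := by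
    have := pos_of_mul_pos_right ht (by positivity : 0 ≤ t⁻¹)
    linarith
  have h2 : 1 < ‖F t‖ := h1.trans_le (Complex.re_le_norm _)
  simp only [F, norm_div, norm_mul, hpq] at h2
  rw [mul_div_mul_right _ _ (norm_ne_zero_iff.2 hq)] at h2
  by_contra! hcon
  exact absurd (div_le_one_of_le₀ hcon (norm_nonneg _)) (not_le.2 h2)

/-- A convex set `{|p| < |q|}` lies in the half-plane bounded by the tangent at a regular
boundary point. -/
theorem Polynomial.re_mul_logDeriv_nonpos {p q : ℂ[X]}
    (hconv : Convex ℝ {z : ℂ | ‖p.eval z‖ < ‖q.eval z‖}) {z w : ℂ} (hp : p.eval z ≠ 0)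
    (hpq : ‖p.eval z‖ = ‖q.eval z‖)
    (hne : p.derivative.eval z / p.eval z - q.derivative.eval z / q.eval z ≠ 0)
    (hw : w ∈ closure {z : ℂ | ‖p.eval z‖ < ‖q.eval z‖}) :
    ((w - z) * (p.derivative.eval z / p.eval z - q.derivative.eval z / q.eval z)).re ≤ 0 := by
  set Ω := {z : ℂ | ‖p.eval z‖ < ‖q.eval z‖} with hΩ
  set D := p.derivative.eval z / p.eval z - q.derivative.eval z / q.eval z with hD
  have hopen : IsOpen Ω := isOpen_lt p.continuous.norm q.continuous.norm
  have hq : q.eval z ≠ 0 := by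
    rw [← norm_ne_zero_iff, ← hpq]
    exact norm_ne_zero_iff.2 hp
  have hline : ∀ d : ℂ, Tendsto (fun t : ℝ => z + t * d) (𝓝[>] 0) (𝓝 z) := by
    intro d
    have h : Continuous fun t : ℝ => z + t * d := by fun_prop
    simpa using (h.tendsto 0).mono_left nhdsWithin_le_nhds
  -- Moving along `-conj D` decreases `|p / q|`, so `z` is a limit of points of `Ω`.
  have hzcl : z ∈ closure Ω := by
    have hpos : 0 < (-(starRingEnd ℂ) D *
        (q.derivative.eval z / q.eval z - p.derivative.eval z / p.eval z)).re := by
      have : -(starRingEnd ℂ) D *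
        (q.derivative.eval z / q.eval z - p.derivative.eval z / p.eval z)
          = (Complex.normSq D : ℂ) := by
        rw [Complex.normSq_eq_conj_mul_self, hD]
        ring
      rw [this, Complex.ofReal_re]
      exact Complex.normSq_pos.2 hne
    exact mem_closure_of_tendsto (hline _)
      (q.eventually_norm_eval_lt p hq hpq.symm hpos)
  refine closure_minimal (t := {w : ℂ | ((w - z) * D).re ≤ 0}) ?_ ?_ hw
  -- If `w ∈ Ω` violated the inequality, the segment from `z` to `w` would start outside `Ω`,
  -- although convexity puts all of it but `z` inside.
  · intro w hw
    by_contra hcon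
    have hpos : 0 < ((w - z) * D).re := not_le.1 hcon
    have h1 := p.eventually_norm_eval_lt q hp hpq hpos
    have h2 : ∀ᶠ t : ℝ in 𝓝[>] 0, t ∈ Set.Ioc (0 : ℝ) 1 := Ioc_mem_nhdsGT one_pos
    obtain ⟨t, ht1, ht2⟩ := (h1.and h2).exists
    have h3 := hconv.add_smul_sub_mem_interior' hzcl (hopen.interior_eq.symm ▸ hw) ht2
    have h4 : z + t * (w - z) ∈ Ω := by simpa using interior_subset h3
    exact absurd ht1 (not_lt.2 (le_of_lt h4))
  · exact isClosed_le (by fun_prop) continuous_const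

/-- Partial fraction expansion of `q / g` for `g` with simple roots, after clearing
denominators. -/
theorem Polynomial.exists_partialFraction {g q : ℂ[X]} (hg : g.Separable)
    (hdeg : q.degree < g.degree) :
    ∃ N : ℂ → ℂ[X], (∀ z ∈ g.roots.toFinset, g = (X - C z) * N z) ∧
      q = ∑ z ∈ g.roots.toFinset, C (q.eval z / g.derivative.eval z) * N z := by
  have hg0 : g ≠ 0 := hg.ne_zero
  have hN : ∀ z ∈ g.roots.toFinset, g = (X - C z) * (g /ₘ (X - C z)) := by
    intro z hz
    rw [Multiset.mem_toFinset, mem_roots hg0] at hz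
    exact (mul_divByMonic_eq_iff_isRoot.2 hz).symm
  refine ⟨fun z => g /ₘ (X - C z), hN, ?_⟩
  have hcard : (g.roots.toFinset.card : WithBot ℕ) = g.degree := by
    rw [Multiset.toFinset_card_of_nodup (nodup_roots hg), degree_eq_natDegree hg0,
      (IsAlgClosed.splits g).natDegree_eq_card_roots]
  -- Lagrange interpolation: both sides have degree below the number of roots of `g` and agree at
  -- each root.
  refine eq_of_degrees_lt_of_eval_finset_eq g.roots.toFinset (by rwa [hcard]) ?_ ?_
  · rw [hcard]
    refine (degree_sum_le _ _).trans_lt ?_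
    rw [Finset.sup_lt_iff (bot_le.trans_lt hdeg)]
    intro z hz
    rw [← smul_eq_C_mul]
    refine (degree_smul_le _ _).trans_lt ?_
    exact degree_divByMonic_lt _ _ hg0 (by rw [degree_X_sub_C]; exact zero_lt_one)
  · intro z hz
    rw [eval_finsetSum, Finset.sum_eq_single_of_mem z hz]
    · have h1 : g.derivative.eval z = (g /ₘ (X - C z)).eval z := by
        conv_lhs => rw [hN z hz]
        simp [derivative_mul]
      have h2 : g.derivative.eval z ≠ 0 := by
        rw [Multiset.mem_toFinset, mem_roots hg0] at hz
        have := hg.eval₂_derivative_ne_zero (RingHom.id ℂ) (x := z) (by simpa using hz)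
        simpa using this
      rw [eval_mul, eval_C, ← h1, div_mul_cancel₀ _ h2]
    · intro w hw hwz
      have hz' : g.eval z = 0 := by
        rw [Multiset.mem_toFinset, mem_roots hg0] at hz
        exact hz
      rw [hN w hw, eval_mul, eval_sub, eval_X, eval_C] at hz'
      rw [eval_mul, (mul_eq_zero.1 hz').resolve_left (sub_ne_zero.2 hwz.symm), mul_zero]

variable {H : Type*} [NormedAddCommGroup H] [InnerProductSpace ℂ H]

theorem exists_mem_numericalRange (A : H →L[ℂ] H) {x : H} (hx : x ≠ 0) :
    ∃ w ∈ numericalRange A, ⟪x, A x⟫_ℂ = (‖x‖ ^ 2 : ℝ) * w := by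
  have hx' : (‖x‖ : ℂ) ≠ 0 := by exact_mod_cast norm_ne_zero_iff.2 hx
  refine ⟨_, ⟨(‖x‖⁻¹ : ℂ) • x, ?_, rfl⟩, ?_⟩
  · exact norm_smul_inv_norm hx
  · rw [map_smul, inner_smul_left, inner_smul_right]
    simp
    field_simp

/-- Points at positive distance from the numerical range are in the resolvent set. -/
theorem isUnit_sub_of_notMem_closure_numericalRange [CompleteSpace H] (A : H →L[ℂ] H) {a : ℂ}
    (ha : a ∉ closure (numericalRange A)) : IsUnit (A - algebraMap ℂ (H →L[ℂ] H) a) := by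
  rw [Metric.mem_closure_iff] at ha
  push Not at ha
  obtain ⟨c, hc, hac⟩ := ha
  refine ContinuousLinearMap.isUnit_of_forall_le_norm_inner_map _ (c := ⟨c, hc.le⟩) hc fun x => ?_
  rcases eq_or_ne x 0 with rfl | hx
  · simp
  obtain ⟨w, hw, hxw⟩ := exists_mem_numericalRange A hx
  have hself : ⟪x, x⟫_ℂ = (‖x‖ ^ 2 : ℝ) := by
    rw [inner_self_eq_norm_sq_to_K]
    push_cast
    rfl
  have h1 : ⟪x, (A - algebraMap ℂ (H →L[ℂ] H) a) x⟫_ℂ = (‖x‖ ^ 2 : ℝ) * (w - a) := by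
    rw [sub_apply, inner_sub_right, hxw, Algebra.algebraMap_eq_smul_one, smul_apply,
      one_apply_eq_self, inner_smul_right, hself]
    ring
  rw [norm_inner_symm, h1, norm_mul, Complex.norm_real, Real.norm_of_nonneg (by positivity),
    ← dist_eq_norm, dist_comm]
  exact mul_le_mul_of_nonneg_left (hac w hw) (by positivity)

theorem isUnit_aeval_of_roots [CompleteSpace H] (A : H →L[ℂ] H) {q : ℂ[X]} (hq : q ≠ 0)
    (h : ∀ a, q.eval a = 0 → a ∉ closure (numericalRange A)) : IsUnit (aeval A q) := by
  rw [(IsAlgClosed.splits q).eq_prod_roots, map_mul, aeval_C]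
  refine IsUnit.mul ((isUnit_iff_ne_zero.2 (leadingCoeff_ne_zero.2 hq)).map _) ?_
  have h2 : ∀ s : Multiset ℂ, (∀ a ∈ s, q.eval a = 0) →
      IsUnit (aeval A (s.map fun a => X - C a).prod) := by
    intro s
    induction s using Multiset.induction with
    | empty => simp
    | cons a s ih =>
      intro hs
      rw [Multiset.map_cons, Multiset.prod_cons, map_mul]
      refine IsUnit.mul ?_ (ih fun b hb => hs b (Multiset.mem_cons_of_mem hb))
      simpa using isUnit_sub_of_notMem_closure_numericalRange A (h a (hs a (by simp)))
  exact h2 _ fun a ha => (mem_roots hq).1 ha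

/-- A closed condition on the unit circle may be checked off a finite set. -/
theorem forall_norm_eq_one_of_finite {P : ℂ → Prop} (hP : IsClosed {ζ | P ζ}) {F : Set ℂ}
    (hF : F.Finite) (h : ∀ ζ, ‖ζ‖ = 1 → ζ ∉ F → P ζ) {ζ : ℂ} (hζ : ‖ζ‖ = 1) : P ζ := by
  -- The circle has no isolated points, so `ζ` is a limit of points of it outside `F`.
  have hpre : Preperfect (Metric.sphere (0 : ℂ) 1) :=
    (isPreconnected_sphere (by simp) _ _).preperfect_of_nontrivial
      ⟨1, by simp, -1, by simp, by norm_num [Complex.ext_iff]⟩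
  have hacc := accPt_iff_frequently_nhdsNE.1 (hpre ζ (by simpa using hζ))
  have hcof : ∀ᶠ y in 𝓝[≠] ζ, y ∉ F := nhdsNE_le_cofinite ζ hF.compl_mem_cofinite
  refine hP.mem_of_frequently_of_tendsto (f := fun y => y) (b := 𝓝[≠] ζ) ?_
    nhdsWithin_le_nhds
  refine (hacc.and_eventually hcof).mono fun y hy => h y ?_ hy.2
  simpa using hy.1

end Lemniscate

/-! ### Kato's inequality for the numerical radius of `f(A)`. -/

section MappingTheorem

open Polynomial
open scoped InnerProductSpace

variable {H : Type*} [NormedAddCommGroup H] [InnerProductSpace ℂ H]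

/-- Kato's inequality at a regular value `ζ` of `p / q` on the unit circle. -/
theorem Polynomial.re_inner_aeval_nonneg {p q : ℂ[X]} (hpq : IsCoprime p q)
    (hdeg : q.degree < p.degree)
    (hconv : Convex ℝ {z : ℂ | ‖p.eval z‖ < ‖q.eval z‖}) (A : H →L[ℂ] H)
    (hA : numericalRange A ⊆ closure {z : ℂ | ‖p.eval z‖ < ‖q.eval z‖}) {ζ : ℂ} (hζ : ‖ζ‖ = 1)
    (hreg : ∀ z, p.eval z = ζ * q.eval z → p.derivative.eval z ≠ ζ * q.derivative.eval z) (y : H) :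
    0 ≤ ((starRingEnd ℂ) ζ * ⟪aeval A q y, aeval A (C ζ * q - p) y⟫_ℂ).re := by
  set g := C ζ * q - p with hg
  have hζ0 : ζ ≠ 0 := norm_ne_zero_iff.1 (hζ ▸ one_ne_zero)
  have hgdeg : g.degree = p.degree := by
    rw [hg, degree_sub_eq_right_of_degree_lt]
    rwa [degree_C_mul hζ0]
  have heval : ∀ z, g.eval z = ζ * q.eval z - p.eval z := by simp [hg]
  have heval' : ∀ z, g.derivative.eval z = ζ * q.derivative.eval z - p.derivative.eval z := by
    simp [hg]
  have hsep : g.Separable := by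
    rw [Separable, isCoprime_iff_aeval_ne_zero_of_isAlgClosed ℂ ℂ]
    intro z
    simp only [coe_aeval_eq_eval, heval, heval', ne_eq, sub_eq_zero]
    by_contra! h
    exact hreg z h.1.symm h.2.symm
  obtain ⟨N, hN, hq⟩ := exists_partialFraction hsep (hdeg.trans_eq hgdeg.symm)
  have hqy : aeval A q y = ∑ z ∈ g.roots.toFinset,
      (q.eval z / g.derivative.eval z) • aeval A (N z) y := by
    conv_lhs => rw [hq]
    simp [map_sum, Algebra.algebraMap_eq_smul_one]
  rw [hqy, sum_inner, Finset.mul_sum, Complex.re_sum]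
  refine Finset.sum_nonneg fun z hz => ?_
  have hgz : g.eval z = 0 := by
    rw [Multiset.mem_toFinset, mem_roots hsep.ne_zero] at hz
    exact hz
  have hpz : p.eval z = ζ * q.eval z := by
    rw [heval, sub_eq_zero] at hgz
    exact hgz.symm
  have hqz : q.eval z ≠ 0 := by
    intro h
    rcases (isCoprime_iff_aeval_ne_zero_of_isAlgClosed ℂ ℂ p q).1 hpq z with h1 | h1
    · simp [hpz, h] at h1
    · simp [h] at h1
  have hpz0 : p.eval z ≠ 0 := hpz ▸ mul_ne_zero hζ0 hqz
  have hg' : g.derivative.eval z ≠ 0 := by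
    rw [heval', sub_ne_zero]
    exact (hreg z hpz).symm
  set D := p.derivative.eval z / p.eval z - q.derivative.eval z / q.eval z with hD
  have hDg : D = -(g.derivative.eval z / (ζ * q.eval z)) := by
    rw [hD, heval', hpz]
    field_simp
    ring
  have hD0 : D ≠ 0 := by
    rw [hDg]
    exact neg_ne_zero.2 (div_ne_zero hg' (mul_ne_zero hζ0 hqz))
  have hgy : aeval A g y = A (aeval A (N z) y) - z • aeval A (N z) y := by
    conv_lhs => rw [hN z hz]
    simp [Algebra.algebraMap_eq_smul_one]
  rw [hgy]
  set u := aeval A (N z) y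
  rcases eq_or_ne u 0 with hu | hu
  · simp [hu]
  obtain ⟨w, hw, huw⟩ := exists_mem_numericalRange A hu
  have hhalf := re_mul_logDeriv_nonpos hconv hpz0
    (by rw [hpz, norm_mul, hζ, one_mul]) hD0 (hA hw)
  rw [← hD] at hhalf
  have hself : ⟪u, u⟫_ℂ = (‖u‖ ^ 2 : ℝ) := by
    rw [inner_self_eq_norm_sq_to_K]
    push_cast
    rfl
  -- `D = -g'(z)/(ζ q(z))`, so the coefficient is `-conj D⁻¹ = -D/|D|²`: a negative multiple of the
  -- tangent half-plane's normal factor.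
  have hc : (starRingEnd ℂ) ζ * (starRingEnd ℂ) (q.eval z / g.derivative.eval z)
      = ((-(Complex.normSq D)⁻¹ : ℝ) : ℂ) * D := by
    have h1 : ζ * (q.eval z / g.derivative.eval z) = -D⁻¹ := by
      rw [hDg]
      field_simp
    rw [← map_mul, h1, map_neg, Complex.inv_def]
    simp [mul_comm]
  have hfin : (starRingEnd ℂ) ζ *
      ⟪(q.eval z / g.derivative.eval z) • u, A u - z • u⟫_ℂ
      = ((‖u‖ ^ 2 * (Complex.normSq D)⁻¹ : ℝ) : ℂ) * -((w - z) * D) := by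
    rw [inner_smul_left, inner_sub_right, inner_smul_right, huw, hself, ← mul_assoc, hc]
    push_cast
    ring
  rw [hfin, Complex.re_ofReal_mul, Complex.neg_re]
  exact mul_nonneg (mul_nonneg (by positivity) (inv_nonneg.2 (Complex.normSq_nonneg D)))
    (neg_nonneg.2 hhalf)

/-- Critical points are zeros of the Wronskian, which is nonzero because `p`, `q` are coprime and
`p` is nonconstant. -/
theorem Polynomial.finite_critical_values {p q : ℂ[X]} (hpq : IsCoprime p q)
    (hp : 0 < p.degree) :
    {ζ : ℂ | ∃ z, p.eval z = ζ * q.eval z ∧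
      p.derivative.eval z = ζ * q.derivative.eval z}.Finite := by
  have hW : wronskian p q ≠ 0 := by
    intro h
    have h1 := derivative_eq_zero.1 (hpq.wronskian_eq_zero_iff.1 h).1
    exact (natDegree_pos_iff_degree_pos.2 hp).ne' h1
  refine ((wronskian p q).roots.toFinset.finite_toSet.image
    fun z => p.eval z / q.eval z).subset ?_
  rintro ζ ⟨z, hz, hz'⟩
  have hqz : q.eval z ≠ 0 := by
    intro h
    rcases (isCoprime_iff_aeval_ne_zero_of_isAlgClosed ℂ ℂ p q).1 hpq z with h1 | h1
    · simp [hz, h] at h1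
    · simp [h] at h1
  refine ⟨z, ?_, ?_⟩
  · rw [Finset.mem_coe, Multiset.mem_toFinset, mem_roots hW, IsRoot, wronskian]
    simp only [eval_sub, eval_mul, hz, hz']
    ring
  · simp only [hz]
    exact mul_div_cancel_right₀ _ hqz

variable [CompleteSpace H]

/-- On the closed lemniscate `|p| ≤ |q|`, so a pole there would be a common zero of `p` and `q`. -/
theorem ratFuncDefinedAt_of_numericalRange_subset {f : RatFunc ℂ} {A : H →L[ℂ] H}
    (hA : numericalRange A ⊆ closure (lemniscate f)) : RatFuncDefinedAt f A := by
  refine isUnit_aeval_of_roots A f.denom_ne_zero fun a ha hmem => ?_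
  have h1 : closure (numericalRange A) ⊆ {z | ‖f.num.eval z‖ ≤ ‖f.denom.eval z‖} := by
    refine closure_minimal (hA.trans ?_)
      (isClosed_le f.num.continuous.norm f.denom.continuous.norm)
    rw [lemniscate_eq]
    exact closure_lt_subset_le f.num.continuous.norm f.denom.continuous.norm
  have h2 : ‖f.num.eval a‖ ≤ ‖f.denom.eval a‖ := h1 hmem
  rw [ha, norm_zero, norm_le_zero_iff] at h2
  rcases (isCoprime_iff_aeval_ne_zero_of_isAlgClosed ℂ ℂ _ _).1 f.isCoprime_num_denom a with h | h
  · simp [h2] at h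
  · simp [ha] at h

/-- **Kato's mapping theorem**: the numerical radius of `f(A)` is at most `1`. -/
theorem re_inner_ratFuncApply_le {f : RatFunc ℂ} (hf : MapsInftyToInfty f)
    (hconv : Convex ℝ (lemniscate f)) {A : H →L[ℂ] H}
    (hA : numericalRange A ⊆ closure (lemniscate f)) (ζ : ℂ) (hζ : ‖ζ‖ = 1) (x : H) :
    (ζ * ⟪x, ratFuncApply f A x⟫_ℂ).re ≤ ‖x‖ ^ 2 := by
  have hunit : IsUnit (aeval A f.denom) := ratFuncDefinedAt_of_numericalRange_subset hA
  have hdeg := hf.degree_denom_lt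
  have hfin := finite_critical_values f.isCoprime_num_denom
    ((zero_le_degree_iff.2 f.denom_ne_zero).trans_lt hdeg)
  rw [lemniscate_eq] at hconv hA
  have hx : x = aeval A f.denom (Ring.inverse (aeval A f.denom) x) := by
    rw [← mul_apply_eq_comp, Ring.mul_inverse_cancel _ hunit, one_apply_eq_self]
  set y := Ring.inverse (aeval A f.denom) x with hy
  have hTx : ratFuncApply f A x = aeval A f.num y := by
    rw [ratFuncApply, mul_apply_eq_comp]
  have hself : ⟪x, x⟫_ℂ = (‖x‖ ^ 2 : ℝ) := by
    rw [inner_self_eq_norm_sq_to_K]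
    push_cast
    rfl
  have key : ∀ ξ : ℂ, ‖ξ‖ = 1 →
      ((starRingEnd ℂ) ξ * ⟪x, ratFuncApply f A x⟫_ℂ).re ≤ ‖x‖ ^ 2 := by
    intro ξ hξ
    refine forall_norm_eq_one_of_finite
      (P := fun ξ => ((starRingEnd ℂ) ξ * ⟪x, ratFuncApply f A x⟫_ℂ).re ≤ ‖x‖ ^ 2)
      (isClosed_le (Complex.continuous_re.comp (Complex.continuous_conj.mul continuous_const))
        continuous_const) hfin ?_ hξ
    intro ξ hξ hreg
    have h := re_inner_aeval_nonneg f.isCoprime_num_denom hdeg hconv A hA hξ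
      (fun z h1 h2 => hreg ⟨z, h1, h2⟩) y
    have hg : aeval A (C ξ * f.denom - f.num) y = ξ • x - ratFuncApply f A x := by
      rw [hTx, map_sub, map_mul, aeval_C, sub_apply, mul_apply_eq_comp, ← hx,
        Algebra.algebraMap_eq_smul_one, smul_apply, one_apply_eq_self]
    have hξξ : (starRingEnd ℂ) ξ * ξ = 1 := by
      rw [← Complex.normSq_eq_conj_mul_self, Complex.normSq_eq_norm_sq, hξ]
      simp
    rw [hg, ← hx, inner_sub_right, inner_smul_right, hself, mul_sub, ← mul_assoc, hξξ, one_mul,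
      Complex.sub_re, Complex.ofReal_re] at h
    linarith
  simpa using key ((starRingEnd ℂ) ζ) (by simpa using hζ)

end MappingTheorem

theorem mainTheorem9 (f : RatFunc ℂ) (hf : MapsInftyToInfty f)
    (hconv : Convex ℝ (lemniscate f))
    {H : Type*} [NormedAddCommGroup H] [InnerProductSpace ℂ H] [CompleteSpace H]
    (A : H →L[ℂ] H) (hA : numericalRange A ⊆ closure (lemniscate f)) :
    RatFuncDefinedAt f A ∧
      numericalRange (ratFuncApply f A) ⊆ Metric.closedBall (0 : ℂ) 1 ∧
      HasUnitaryTwoDilation (ratFuncApply f A) := by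
  have hT := re_inner_ratFuncApply_le hf hconv hA
  refine ⟨ratFuncDefinedAt_of_numericalRange_subset hA, ?_,
    hasUnitaryTwoDilation_of_re_inner_le hT⟩
  rintro _ ⟨x, hx, rfl⟩
  obtain ⟨ζ, hζ, hζx⟩ := RCLike.exists_norm_eq_mul_self (inner ℂ x (ratFuncApply f A x))
  have h := hT ζ hζ x
  rw [← hζx, hx, one_pow] at h
  rw [mem_closedBall_zero_iff]
  simpa using h
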